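/- Let $\mathcal D=\mathbb C(t_1,t_2,t_3)\langle\partial_1,\partial_2,\partial_3\rangle$ be the ring of linear differential operators in three variables with rational coefficients ($\partial_i=\partial/\partial t_i$, $\partial_{ij}=\partial_i\partial_j$). The rank of a system of operators $P_1,P_2,P_3\in\mathcal D$ is $\dim_{\mathbb C(t_1,t_2,t_3)}\mathcal D/(\mathcal DP_1+\mathcal DP_2+\mathcal DP_3)$. **Theorem 1.1.** Let $a_{ij}\in\mathbb C$ ($i=1,2,3$, $j=0,1,2,3$), and for each cyclic permutation $(i,j,k)$ of $(1,2,3)$ put $$E_i=(1-t_j^2)\partial_{jj}+2(t_i-t_jt_k)\partial_{jk}+(1-t_k^2)\partial_{kk}+a_{i1}t_1\partial_1+a_{i2}t_2\partial_2+a_{i3}t_3\partial_3+a_{i0}.$$ The system $E_1,E_2,E_3$ has rank $8$ if and only if $$a_{11}=a_{22}=a_{33}=0,\qquad a_{12}=a_{13}=a_{21}=a_{23}=a_{31}=a_{32}.$$ Moreover, suppose that these conditions hold, and let $a_0$ be the common value of the $a_{ij}$ with $i\ne j$, $i,j\ge1$. Then there is $A=(A_0,A_1,A_2,A_3)\in\mathbb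 C^4$ with $$a_0=2A_0-3,\qquad a_{i0}=A_i^2-(A_0-1)^2\quad(i=1,2,3),$$ and for every such $A$ the system $(E_1,E_2,E_3)$ is the system $Z_3(A)$ consisting of the operators $$(1-t_j^2)\partial_{jj}+2(t_i-t_jt_k)\partial_{jk}+(1-t_k^2)\partial_{kk}+(2A_0-3)(t_j\partial_j+t_k\partial_k)+A_i^2-(A_0-1)^2,$$ one for each cyclic permutation $(i,j,k)$ of $(1,2,3)$. For every $A\in\mathbb C^4$ the system $Z_3(A)$ has rank $8$. -/

import Mathlib

noncomputable section

namespace Fuchs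

/-- The field `ℂ(t₁, t₂, t₃)` of rational functions. The variables `t₁, t₂, t₃` are
indexed by `0, 1, 2 : Fin 3`. -/
abbrev RatField : Type := FractionRing (MvPolynomial (Fin 3) ℂ)

/-- The rational function `tᵢ`. -/
def tvar (i : Fin 3) : RatField := algebraMap (MvPolynomial (Fin 3) ℂ) RatField (MvPolynomial.X i)

/-- The free algebra on one symbol for each rational function and symbols `∂₁, ∂₂, ∂₃`. -/
abbrev FreeOp : Type := FreeAlgebra ℂ (RatField ⊕ Fin 3)

/-- The symbol of a rational function. -/
def freeCoeff (f : RatField) : FreeOp := FreeAlgebra.ι ℂ (Sum.inl f)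

/-- The symbol `∂ᵢ`. -/
def freeDeriv (i : Fin 3) : FreeOp := FreeAlgebra.ι ℂ (Sum.inr i)

/-- The defining relations of the ring of differential operators `ℂ(t₁,t₂,t₃)⟨∂₁,∂₂,∂₃⟩`:
the rational functions form a `ℂ`-subalgebra, the `∂ᵢ` commute with one another, and
`∂ᵢ tⱼ = tⱼ ∂ᵢ + δᵢⱼ`. (The Leibniz rule `∂ᵢ f = f ∂ᵢ + ∂f/∂tᵢ` for all rational functions `f`
follows, as `g g⁻¹ = 1` forces `∂ᵢ g⁻¹ - g⁻¹ ∂ᵢ = - g⁻¹ (∂ᵢ g - g ∂ᵢ) g⁻¹`.) -/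
inductive OpRel : FreeOp → FreeOp → Prop
  | scalar (c : ℂ) : OpRel (freeCoeff (algebraMap ℂ RatField c)) (algebraMap ℂ FreeOp c)
  | add (f g : RatField) : OpRel (freeCoeff (f + g)) (freeCoeff f + freeCoeff g)
  | mul (f g : RatField) : OpRel (freeCoeff (f * g)) (freeCoeff f * freeCoeff g)
  | comm (i j : Fin 3) : OpRel (freeDeriv i * freeDeriv j) (freeDeriv j * freeDeriv i)
  | leibniz (i j : Fin 3) :
      OpRel (freeDeriv i * freeCoeff (tvar j))
        (freeCoeff (tvar j) * freeDeriv i + if i = j then 1 else 0)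

/-- The ring `ℂ(t₁,t₂,t₃)⟨∂₁,∂₂,∂₃⟩` of linear differential operators in three variables with
rational coefficients. -/
def DiffOp : Type := RingQuot OpRel

instance : Ring DiffOp := inferInstanceAs (Ring (RingQuot OpRel))

instance : Algebra ℂ DiffOp := inferInstanceAs (Algebra ℂ (RingQuot OpRel))

/-- The quotient map from the free algebra. -/
def mkOp : FreeOp →ₐ[ℂ] DiffOp := RingQuot.mkAlgHom ℂ OpRel

theorem mkOp_rel {x y : FreeOp} (h : OpRel x y) : mkOp x = mkOp y :=
  RingQuot.mkAlgHom_rel ℂ h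

/-- A rational function, as an operator of order zero. -/
def coeff : RatField →ₐ[ℂ] DiffOp where
  toFun f := mkOp (freeCoeff f)
  map_one' := by
    have h := mkOp_rel (OpRel.scalar 1)
    rwa [map_one, map_one, map_one] at h
  map_mul' f g := by rw [mkOp_rel (OpRel.mul f g), map_mul]
  map_zero' := by
    have h := mkOp_rel (OpRel.scalar 0)
    rwa [map_zero, map_zero, map_zero] at h
  map_add' f g := by rw [mkOp_rel (OpRel.add f g), map_add]
  commutes' c := by rw [mkOp_rel (OpRel.scalar c), AlgHom.commutes]

/-- The operator `∂ᵢ = ∂/∂tᵢ`. -/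
def deriv (i : Fin 3) : DiffOp := mkOp (freeDeriv i)

/-- The operator of multiplication by `tᵢ`. -/
def t (i : Fin 3) : DiffOp := coeff (tvar i)

/-- Differential operators form a vector space over the rational functions, by multiplication
from the left. -/
instance : Module RatField DiffOp := Module.compHom DiffOp coeff.toRingHom

instance : IsScalarTower RatField DiffOp DiffOp :=
  ⟨fun f P Q => mul_assoc (coeff f) P Q⟩

/-- A system of three operators, which stands for the left ideal that they generate. -/
abbrev DiffSystem : Type := Fin 3 → DiffOp

/-- The left ideal generated by a system. -/
def DiffSystem.ideal (P : DiffSystem) : Submodule DiffOp DiffOp :=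
  Submodule.span DiffOp (Set.range P)

/-- The rank of a system: the dimension over `ℂ(t₁,t₂,t₃)` of the quotient of the ring of
differential operators by the left ideal that the system generates. -/
def DiffSystem.rank (P : DiffSystem) : Cardinal :=
  Module.rank RatField (DiffOp ⧸ P.ideal)

/-- For `(i, j, k)` a cyclic permutation of `(1, 2, 3)`, the second order part
`(1 - tⱼ²) ∂ⱼⱼ + 2 (tᵢ - tⱼ tₖ) ∂ⱼₖ + (1 - tₖ²) ∂ₖₖ`. Addition in `Fin 3` is cyclic. -/
def principalPart (i : Fin 3) : DiffOp :=
  (1 - t (i + 1) ^ 2) * deriv (i + 1) ^ 2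
    + 2 * (t i - t (i + 1) * t (i + 2)) * (deriv (i + 1) * deriv (i + 2))
    + (1 - t (i + 2) ^ 2) * deriv (i + 2) ^ 2

/-- The operators `Eᵢ`, with constants `a i j` for `aᵢⱼ` (`j = 1, 2, 3`) and `b i` for `aᵢ₀`. -/
def E (a : Fin 3 → Fin 3 → ℂ) (b : Fin 3 → ℂ) : DiffSystem := fun i =>
  principalPart i + ∑ j, algebraMap ℂ DiffOp (a i j) * t j * deriv j + algebraMap ℂ DiffOp (b i)

/-- The system `Z₃(A)`, where `A = (A₀, A₁, A₂, A₃)`. -/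
def Z3 (A : Fin 4 → ℂ) : DiffSystem := fun i =>
  principalPart i
    + algebraMap ℂ DiffOp (2 * A 0 - 3)
      * (t (i + 1) * deriv (i + 1) + t (i + 2) * deriv (i + 2))
    + algebraMap ℂ DiffOp (A i.succ ^ 2 - (A 0 - 1) ^ 2)

end Fuchs

end

/-!
Write `K` for the field of rational functions and `D` for the ring of differential operators. The
argument has two ingredients.

*A basis of `D` adapted to the system.* The operators `Pᵢ = (Eⱼ + Eₖ - Eᵢ) / 2` generate the same
left ideal as the `Eᵢ`, and at the origin `t = 0` the part of order `2` of `Pᵢ` is `∂ᵢ²`. Hence the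
operator `B_γ = ∂^α P₁^β₁ P₂^β₂ P₃^β₃`, where `γ = α + 2 β` with `α ∈ {0, 1}³`, is congruent to
`∂^γ` modulo operators of lower order and operators whose coefficients vanish at the origin. By
Nakayama's lemma over `ℂ[t₁, t₂, t₃]` the `B_γ` with `|γ| < n` span all operators of order less
than `n` over `K`, and as they are as many as the `∂^γ`, they are independent
(`LeadsSquares.span_le`, `LeadsSquares.linearIndependent_adapted`). So the `B_γ` are a `K`-basis
of `D`, whatever the system. Those with `β ≠ 0` lie in the ideal, and the others are eight in number;
therefore the rank is `8` if and only if the ideal is the span of the `B_γ` with `β ≠ 0`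
(`LeadsSquares.rank_eq_iff`).

*The commutators* (`commutator_E`). For constants of the special form the `Eᵢ` commute: for suitable
values of `a₀` they are, up to constants, the Laplacians in three points of a sphere, acting on
functions of the inner products `t₁, t₂, t₃` of these points. Then right multiplication by `Pᵢ`
sends `B_γ` to another basis element, the ideal is the span of the `B_γ` with `β ≠ 0`, and the rank
is `8`. In general `[Eᵢ, Eⱼ]` has order at most `2`, with coefficients linear in the `aᵢⱼ`. If the
rank is `8`, then, as an element of order at most `2` of the ideal, it must be a combination of `P₁,
P₂, P₃` over `K` (`LeadsSquares.exists_eq_sum`). Comparing the terms of order `2` gives `p (1 - tᵢ²)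
= -2 aᵢᵢ`, `q (1 - tⱼ²) = 2 aⱼⱼ`, `r (1 - tₖ²) = 2 (aⱼₖ - aᵢₖ)` and `p + q = r` for the coefficients
`p, q, r` of the combination, which is possible only if all of them vanish; the remaining terms then
give the other relations.
-/

noncomputable section

namespace Fuchs

open MvPolynomial

/-! ### The derivations of the field of rational functions -/

/-- The lift of `∂/∂tᵢ` to an algebra map from rational functions to dual numbers,
`f ↦ f + ε ∂f/∂tᵢ`. -/
def dualLift (i : Fin 3) : RatField →ₐ[ℂ] TrivSqZeroExt RatField RatField :=
  IsLocalization.liftAlgHom (M := nonZeroDivisors (MvPolynomial (Fin 3) ℂ))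
    (f := aeval fun j => TrivSqZeroExt.inl (tvar j) + TrivSqZeroExt.inr (if i = j then 1 else 0))
    (by
      intro y
      rw [TrivSqZeroExt.isUnit_iff_isUnit_fst]
      have h : (TrivSqZeroExt.fstHom ℂ RatField RatField).comp
          (aeval fun j => TrivSqZeroExt.inl (tvar j) +
            TrivSqZeroExt.inr (if i = j then 1 else 0)) =
          Algebra.algHom ℂ (MvPolynomial (Fin 3) ℂ) RatField := by
        ext j
        by_cases hij : i = j <;> simp [tvar, Algebra.algHom, hij]
      have h' := DFunLike.congr_fun h y.1
      simp only [AlgHom.comp_apply, TrivSqZeroExt.fstHom_apply] at h'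
      rw [h']
      exact (map_ne_zero_iff _ (IsFractionRing.injective _ _)).2
        (nonZeroDivisors.coe_ne_zero y) |>.isUnit)

theorem dualLift_tvar (i j : Fin 3) : dualLift i (tvar j) =
    TrivSqZeroExt.inl (tvar j) + TrivSqZeroExt.inr (if i = j then 1 else 0) := by
  rw [dualLift, tvar, IsLocalization.liftAlgHom_apply, IsLocalization.lift_eq]
  simp [tvar]

theorem fst_dualLift (i : Fin 3) (f : RatField) : (dualLift i f).fst = f := by
  have h : (TrivSqZeroExt.fstHom ℂ RatField RatField).comp (dualLift i) = AlgHom.id ℂ _ := by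
    apply IsLocalization.algHom_ext (nonZeroDivisors (MvPolynomial (Fin 3) ℂ))
    ext j
    have := congrArg TrivSqZeroExt.fst (dualLift_tvar i j)
    split_ifs at this <;> simpa [tvar, Algebra.algHom] using this
  exact DFunLike.congr_fun h f

/-- The derivation `∂/∂tᵢ` of the field of rational functions. -/
def partialDer (i : Fin 3) : Derivation ℂ RatField RatField :=
  Derivation.mk' ((TrivSqZeroExt.sndHom RatField RatField).restrictScalars ℂ ∘ₗ
    (dualLift i).toLinearMap) (by
      intro f g
      simp [TrivSqZeroExt.snd_mul, fst_dualLift, mul_comm])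

theorem partialDer_tvar (i j : Fin 3) : partialDer i (tvar j) = if i = j then 1 else 0 := by
  have := congrArg TrivSqZeroExt.snd (dualLift_tvar i j)
  split_ifs at this ⊢ <;> simpa [partialDer] using this

/-- A derivation of the rational functions is determined by its values at the variables. -/
theorem derivation_eq_zero (d : Derivation ℂ RatField RatField) (h : ∀ j, d (tvar j) = 0) :
    d = 0 := by
  have h0 : d.compAlgebraMap (MvPolynomial (Fin 3) ℂ) = 0 := by
    apply MvPolynomial.derivation_ext
    intro j
    simpa [tvar] using h j
  have h1 : ∀ p : MvPolynomial (Fin 3) ℂ, d (algebraMap _ _ p) = 0 := fun p => by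
    simpa using DFunLike.congr_fun h0 p
  ext f
  obtain ⟨p, q, -, rfl⟩ := IsFractionRing.div_surjective (A := MvPolynomial (Fin 3) ℂ) f
  simp [Derivation.leibniz_div, h1]

theorem partialDer_comm (i j : Fin 3) (f : RatField) :
    partialDer i (partialDer j f) = partialDer j (partialDer i f) := by
  have h : ⁅partialDer i, partialDer j⁆ = 0 := by
    apply derivation_eq_zero
    intro k
    rw [Derivation.commutator_apply, partialDer_tvar, partialDer_tvar]
    split_ifs <;> simp
  have := DFunLike.congr_fun h f
  rwa [Derivation.commutator_apply, Derivation.zero_apply, sub_eq_zero] at this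

theorem partialDer_algebraMap (i : Fin 3) (p : MvPolynomial (Fin 3) ℂ) :
    partialDer i (algebraMap _ _ p) = algebraMap _ _ (pderiv i p) := by
  have h : (partialDer i).compAlgebraMap (MvPolynomial (Fin 3) ℂ) =
      (Algebra.linearMap (MvPolynomial (Fin 3) ℂ) RatField).compDer (pderiv i) := by
    apply MvPolynomial.derivation_ext
    intro j
    have := partialDer_tvar i j
    simp only [tvar] at this
    simp [pderiv_X, this, Pi.single_apply, eq_comm]
  simpa using DFunLike.congr_fun h p

/-! ### Operators acting on rational functions -/

/-- The action of the free algebra on rational functions. -/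
def freeAction : FreeOp →ₐ[ℂ] Module.End ℂ RatField :=
  FreeAlgebra.lift ℂ (Sum.elim (fun f => LinearMap.mulLeft ℂ f)
    fun i => (partialDer i : RatField →ₗ[ℂ] RatField))

theorem freeAction_rel {x y : FreeOp} (h : OpRel x y) : freeAction x = freeAction y := by
  induction h with
  | scalar c => ext f; simp [freeAction, freeCoeff, Algebra.smul_def]
  | add f g => ext h; simp [freeAction, freeCoeff, add_mul]
  | mul f g => ext h; simp [freeAction, freeCoeff]
  | comm i j => ext f; simpa [freeAction, freeDeriv] using partialDer_comm i j f
  | leibniz i j =>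
    ext f
    split_ifs with hij <;> simp [freeAction, freeCoeff, freeDeriv, partialDer_tvar, hij]

/-- The action of differential operators on rational functions. -/
def action : DiffOp →ₐ[ℂ] Module.End ℂ RatField :=
  RingQuot.liftAlgHom ℂ ⟨freeAction, fun _ _ h => freeAction_rel h⟩

theorem action_mkOp (x : FreeOp) : action (mkOp x) = freeAction x :=
  RingQuot.liftAlgHom_mkAlgHom_apply ℂ freeAction _ x

@[simp]
theorem action_coeff (f g : RatField) : action (coeff f) g = f * g := by
  have : coeff f = mkOp (freeCoeff f) := rfl
  rw [this, action_mkOp]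
  simp [freeAction, freeCoeff]

@[simp]
theorem action_deriv (i : Fin 3) (g : RatField) : action (deriv i) g = partialDer i g := by
  rw [deriv, action_mkOp]
  simp [freeAction, freeDeriv]

theorem smul_eq_coeff_mul (f : RatField) (X : DiffOp) : f • X = coeff f * X := rfl

@[simp]
theorem action_smul (f g : RatField) (X : DiffOp) : action (f • X) g = f * action X g := by
  rw [smul_eq_coeff_mul, map_mul, Module.End.mul_apply, action_coeff]

/-! ### The Leibniz rule -/

theorem deriv_comm (i j : Fin 3) : deriv i * deriv j = deriv j * deriv i := by
  simpa [deriv] using mkOp_rel (OpRel.comm i j)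

theorem deriv_mul_t (i j : Fin 3) :
    deriv i * coeff (tvar j) = coeff (tvar j) * deriv i + coeff (if i = j then 1 else 0) := by
  have h := mkOp_rel (OpRel.leibniz i j)
  rw [map_mul, map_add, map_mul] at h
  rw [deriv]
  refine h.trans ?_
  congr 1
  split_ifs <;> simp

theorem deriv_mul_coeff (i : Fin 3) (f : RatField) :
    deriv i * coeff f = coeff f * deriv i + coeff (partialDer i f) := by
  have hpoly : ∀ p : MvPolynomial (Fin 3) ℂ, deriv i * coeff (algebraMap _ _ p) =
      coeff (algebraMap _ _ p) * deriv i + coeff (partialDer i (algebraMap _ _ p)) := by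
    intro p
    induction p using MvPolynomial.induction_on with
    | C a =>
      have h : algebraMap (MvPolynomial (Fin 3) ℂ) RatField (C a) = algebraMap ℂ RatField a :=
        (IsScalarTower.algebraMap_apply ℂ (MvPolynomial (Fin 3) ℂ) RatField a).symm
      rw [h, AlgHom.commutes, Derivation.map_algebraMap, map_zero, add_zero, Algebra.commutes]
    | add p q hp hq => simp only [map_add, mul_add, add_mul, hp, hq]; abel
    | mul_X p j hp =>
      have hX : algebraMap (MvPolynomial (Fin 3) ℂ) RatField (X j) = tvar j := rfl
      rw [map_mul, map_mul, hX, ← mul_assoc, hp, add_mul, mul_assoc, deriv_mul_t, mul_add,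
        Derivation.leibniz, partialDer_tvar, map_add, smul_eq_mul, smul_eq_mul, map_mul, map_mul,
        ← map_mul coeff (tvar j), mul_comm (tvar j), map_mul]
      noncomm_ring
  obtain ⟨p, q, hq, rfl⟩ := IsFractionRing.div_surjective (A := MvPolynomial (Fin 3) ℂ) f
  have hq0 : algebraMap (MvPolynomial (Fin 3) ℂ) RatField q ≠ 0 :=
    (map_ne_zero_iff _ (IsFractionRing.injective _ _)).2 (nonZeroDivisors.ne_zero hq)
  set u := algebraMap (MvPolynomial (Fin 3) ℂ) RatField p
  set v := algebraMap (MvPolynomial (Fin 3) ℂ) RatField q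
  have hu : deriv i * coeff u = coeff u * deriv i + coeff (partialDer i u) := hpoly p
  have hv : deriv i * coeff v = coeff v * deriv i + coeff (partialDer i v) := hpoly q
  -- Multiplication by `v` from the right is injective, so it is enough to compare after it.
  have hinj : ∀ X Y : DiffOp, X * coeff v = Y * coeff v → X = Y := by
    intro X Y h
    have := congrArg (· * coeff v⁻¹) h
    simpa only [mul_assoc, ← map_mul, mul_inv_cancel₀ hq0, map_one, mul_one] using this
  apply hinj
  rw [mul_assoc, ← map_mul, div_mul_cancel₀ _ hq0, hu, add_mul, mul_assoc, hv, mul_add,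
    ← mul_assoc, ← map_mul, div_mul_cancel₀ _ hq0, add_assoc, ← map_mul, ← map_mul, ← map_add]
  congr 2
  rw [Derivation.leibniz_div]
  simp only [smul_eq_mul]
  field_simp
  ring

theorem deriv_mul_smul (i : Fin 3) (f : RatField) (X : DiffOp) :
    deriv i * f • X = f • (deriv i * X) + partialDer i f • X := by
  simp only [smul_eq_coeff_mul, ← mul_assoc, deriv_mul_coeff, add_mul]

/-! ### The basis of monomials in the derivations -/

/-- The operator `∂₁^γ₁ ∂₂^γ₂ ∂₃^γ₃`. -/
def dmon (γ : Fin 3 → ℕ) : DiffOp := deriv 0 ^ γ 0 * deriv 1 ^ γ 1 * deriv 2 ^ γ 2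

@[simp]
theorem dmon_zero : dmon 0 = 1 := by simp [dmon]

theorem commute_deriv (i j : Fin 3) : Commute (deriv i) (deriv j) := deriv_comm i j

theorem commute_deriv_dmon (i : Fin 3) (γ : Fin 3 → ℕ) : Commute (deriv i) (dmon γ) :=
  (((commute_deriv i 0).pow_right _).mul_right ((commute_deriv i 1).pow_right _)).mul_right
    ((commute_deriv i 2).pow_right _)

theorem deriv_mul_dmon (i : Fin 3) (γ : Fin 3 → ℕ) :
    deriv i * dmon γ = dmon (γ + Pi.single i 1) := by
  have h10 := ((commute_deriv 1 0).pow_right (γ 0)).eq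
  fin_cases i
  · simp [dmon, pow_succ', mul_assoc]
  · simp only [dmon, Fin.mk_one, Pi.add_apply, ← mul_assoc]
    rw [h10]
    simp [pow_succ', mul_assoc]
  · have h : deriv 2 * dmon γ = dmon γ * deriv 2 := (commute_deriv_dmon 2 γ).eq
    simp only [Fin.reduceFinMk]
    rw [h]
    simp [dmon, pow_succ, mul_assoc]

theorem dmon_mul_deriv (i : Fin 3) (γ : Fin 3 → ℕ) :
    dmon γ * deriv i = dmon (γ + Pi.single i 1) := by
  rw [← (commute_deriv_dmon i γ).eq, deriv_mul_dmon]

theorem multiindex_induction {p : (Fin 3 → ℕ) → Prop} (zero : p 0)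
    (add_single : ∀ γ i, p γ → p (γ + Pi.single i 1)) (γ : Fin 3 → ℕ) : p γ := by
  induction hn : ∑ i, γ i generalizing γ with
  | zero =>
    have : γ = 0 := by
      ext i
      simpa using Finset.sum_eq_zero_iff.1 hn i (Finset.mem_univ i)
    simpa [this] using zero
  | succ n ih =>
    obtain ⟨i, -, hi⟩ := Finset.exists_ne_zero_of_sum_ne_zero (hn.trans_ne n.succ_ne_zero)
    obtain ⟨δ, rfl⟩ : ∃ δ, γ = δ + Pi.single i 1 := by
      refine ⟨γ - Pi.single i 1, (tsub_add_cancel_of_le ?_).symm⟩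
      intro j
      by_cases h : j = i
      · subst h; simpa using Nat.one_le_iff_ne_zero.2 hi
      · simp [h]
    apply add_single
    apply ih
    simpa [Finset.sum_add_distrib] using hn

theorem dmon_mul_dmon (γ δ : Fin 3 → ℕ) : dmon γ * dmon δ = dmon (γ + δ) := by
  induction δ using multiindex_induction with
  | zero => simp
  | add_single δ i ih => rw [← dmon_mul_deriv, ← mul_assoc, ih, dmon_mul_deriv, add_assoc]

theorem action_deriv_pow (i : Fin 3) (n : ℕ) (s : Fin 3 →₀ ℕ) (a : ℂ) :
    action (deriv i ^ n) (algebraMap _ _ (monomial s a)) =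
      algebraMap (MvPolynomial (Fin 3) ℂ) RatField
        (monomial (s - Finsupp.single i n) (a * (s i).descFactorial n)) := by
  induction n with
  | zero => simp
  | succ n ih =>
    rw [pow_succ', map_mul, Module.End.mul_apply, ih, action_deriv, partialDer_algebraMap,
      pderiv_monomial, Nat.descFactorial_succ, tsub_tsub, ← Finsupp.single_add]
    simp [mul_comm, mul_left_comm]

theorem action_dmon (γ : Fin 3 → ℕ) (s : Fin 3 →₀ ℕ) :
    action (dmon γ) (algebraMap (MvPolynomial (Fin 3) ℂ) RatField (monomial s 1)) =
      algebraMap (MvPolynomial (Fin 3) ℂ) RatField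
        (monomial (s - Finsupp.equivFunOnFinite.symm γ) (∏ i, ((s i).descFactorial (γ i) : ℂ))) := by
  have hs : s - Finsupp.single 2 (γ 2) - Finsupp.single 1 (γ 1) - Finsupp.single 0 (γ 0) =
      s - Finsupp.equivFunOnFinite.symm γ := by
    ext i
    fin_cases i <;> simp
  rw [dmon, map_mul, map_mul, Module.End.mul_apply, Module.End.mul_apply, action_deriv_pow,
    action_deriv_pow, action_deriv_pow, hs]
  simp only [Fin.prod_univ_three, Finsupp.tsub_apply, Finsupp.single_apply]
  simp only [Fin.reduceEq, if_false, tsub_zero, one_mul]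
  congr 2
  ring

theorem eq_zero_of_action_eq_zero (l : (Fin 3 → ℕ) →₀ RatField)
    (hl : action (Finsupp.linearCombination RatField dmon l) = 0) : l = 0 := by
  by_contra hne
  -- Apply the relation to the monomial of an exponent that is minimal in it: all other terms vanish.
  obtain ⟨δ, hδ, hmin⟩ := Finset.exists_min_image l.support (fun γ => ∑ i, γ i)
    (Finsupp.support_nonempty_iff.2 hne)
  have h := congrArg (fun X => X (algebraMap (MvPolynomial (Fin 3) ℂ) RatField
    (monomial (Finsupp.equivFunOnFinite.symm δ) 1))) hl
  simp only [Finsupp.linearCombination_apply, Finsupp.sum, map_sum, LinearMap.sum_apply,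
    action_smul, action_dmon, LinearMap.zero_apply] at h
  rw [Finset.sum_eq_single_of_mem δ hδ] at h
  · have hprod : (∏ i, ((δ i).descFactorial (δ i) : ℂ)) ≠ 0 :=
      Finset.prod_ne_zero_iff.2 fun i _ => by simp [Nat.descFactorial_self, Nat.factorial_ne_zero]
    rcases mul_eq_zero.1 h with h | h
    · exact Finsupp.mem_support_iff.1 hδ h
    · rw [map_eq_zero_iff _ (IsFractionRing.injective _ _), monomial_eq_zero] at h
      exact hprod h
  · intro γ hγ hγδ
    obtain ⟨i, hi⟩ : ∃ i, δ i < γ i := by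
      by_contra! hle
      refine hγδ (funext fun i => ?_)
      exact (Finset.sum_eq_sum_iff_of_le fun i _ => hle i).1
        (le_antisymm (Finset.sum_le_sum fun i _ => hle i) (hmin γ hγ)) i (Finset.mem_univ i)
    rw [Finset.prod_eq_zero (Finset.mem_univ i) (by simpa using hi)]
    simp

theorem linearIndependent_dmon : LinearIndependent RatField dmon := by
  rw [linearIndependent_iff]
  intro l hl
  exact eq_zero_of_action_eq_zero l (by rw [hl, map_zero])

theorem mkOp_surjective : Function.Surjective mkOp := RingQuot.mkAlgHom_surjective ℂ OpRel

theorem span_dmon : Submodule.span RatField (Set.range dmon) = ⊤ := by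
  set V := Submodule.span RatField (Set.range dmon)
  have hderiv : ∀ i, ∀ v ∈ V, deriv i * v ∈ V := by
    intro i v hv
    induction hv using Submodule.span_induction with
    | mem x hx =>
      obtain ⟨γ, rfl⟩ := hx
      rw [deriv_mul_dmon]
      exact Submodule.subset_span ⟨_, rfl⟩
    | zero => simp
    | add x y _ _ hx hy => rw [mul_add]; exact V.add_mem hx hy
    | smul f x hx' hx =>
      rw [deriv_mul_smul]
      exact V.add_mem (V.smul_mem _ hx) (V.smul_mem _ hx')
  have hmul : ∀ x : FreeOp, ∀ v ∈ V, mkOp x * v ∈ V := by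
    intro x
    induction x using FreeAlgebra.induction with
    | grade0 c =>
      intro v hv
      rw [AlgHom.commutes, ← coeff.commutes c]
      exact V.smul_mem _ hv
    | grade1 x =>
      rcases x with f | i
      · exact fun v hv => V.smul_mem f hv
      · exact hderiv i
    | mul a b ha hb => intro v hv; rw [map_mul, mul_assoc]; exact ha _ (hb v hv)
    | add a b ha hb => intro v hv; rw [map_add, add_mul]; exact V.add_mem (ha v hv) (hb v hv)
  rw [eq_top_iff]
  rintro X -
  obtain ⟨x, rfl⟩ := mkOp_surjective X
  have := hmul x 1 (Submodule.subset_span ⟨0, dmon_zero⟩)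
  rwa [mul_one] at this

/-- Differential operators are determined by their action on rational functions. -/
theorem action_injective : Function.Injective action := by
  rw [injective_iff_map_eq_zero]
  intro X hX
  have hmem : X ∈ Submodule.span RatField (Set.range dmon) := by
    rw [span_dmon]; exact Submodule.mem_top
  obtain ⟨l, rfl⟩ := Finsupp.mem_span_range_iff_exists_finsupp.1 hmem
  rw [← Finsupp.linearCombination_apply] at hX ⊢
  rw [eq_zero_of_action_eq_zero l hX, map_zero]

/-! ### Leading terms at the origin -/

/-- The polynomial ring `ℂ[t₁, t₂, t₃]`. -/
abbrev Poly : Type := MvPolynomial (Fin 3) ℂ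

instance : Module Poly DiffOp := Module.compHom DiffOp (algebraMap Poly RatField)

instance : IsScalarTower Poly RatField DiffOp :=
  ⟨fun p f X => by rw [Algebra.smul_def, mul_smul]; rfl⟩

theorem poly_smul_eq (p : Poly) (X : DiffOp) : p • X = algebraMap Poly RatField p • X := rfl

theorem poly_smul_mul (p : Poly) (X Y : DiffOp) : p • X * Y = p • (X * Y) :=
  smul_mul_assoc (algebraMap Poly RatField p) X Y

theorem deriv_mul_poly_smul (i : Fin 3) (p : Poly) (X : DiffOp) :
    deriv i * p • X = p • (deriv i * X) + pderiv i p • X := by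
  simp only [poly_smul_eq, deriv_mul_smul, partialDer_algebraMap]

/-- The ideal of the polynomials that vanish at the origin. -/
def originIdeal : Ideal Poly := RingHom.ker (constantCoeff (σ := Fin 3) (R := ℂ))

/-- The operators of order less than `n` with polynomial coefficients. -/
def orderLT (n : ℕ) : Submodule Poly DiffOp :=
  Submodule.span Poly (dmon '' {γ | ∑ i, γ i < n})

/-- The operators of order at most `n` with polynomial coefficients, those in order `n` being
zero at the origin. -/
def vanishingTop (n : ℕ) : Submodule Poly DiffOp :=
  originIdeal • orderLT (n + 1) ⊔ orderLT n

theorem dmon_mem_orderLT {γ : Fin 3 → ℕ} {n : ℕ} (h : ∑ i, γ i < n) : dmon γ ∈ orderLT n :=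
  Submodule.subset_span ⟨γ, h, rfl⟩

theorem orderLT_mono {m n : ℕ} (h : m ≤ n) : orderLT m ≤ orderLT n :=
  Submodule.span_mono (Set.image_mono fun _ hγ => lt_of_lt_of_le hγ h)

theorem vanishingTop_le (n : ℕ) : vanishingTop n ≤ orderLT (n + 1) :=
  sup_le Submodule.smul_le_right (orderLT_mono n.le_succ)

theorem sum_add_single (γ : Fin 3 → ℕ) (i : Fin 3) (k : ℕ) :
    ∑ j, (γ + Pi.single i k : Fin 3 → ℕ) j = ∑ j, γ j + k := by
  simp [Finset.sum_add_distrib]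

theorem deriv_mul_mem_orderLT (i : Fin 3) {n : ℕ} {X : DiffOp} (hX : X ∈ orderLT n) :
    deriv i * X ∈ orderLT (n + 1) := by
  induction hX using Submodule.span_induction with
  | mem x hx =>
    obtain ⟨γ, hγ, rfl⟩ := hx
    rw [deriv_mul_dmon]
    apply dmon_mem_orderLT
    rw [sum_add_single]
    exact Nat.succ_lt_succ hγ
  | zero => simp
  | add x y _ _ hx hy => rw [mul_add]; exact add_mem hx hy
  | smul p x hx' hx =>
    rw [deriv_mul_poly_smul]
    exact add_mem (Submodule.smul_mem _ _ hx)
      (Submodule.smul_mem _ _ (orderLT_mono n.le_succ hx'))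

theorem deriv_mul_mem_vanishingTop (i : Fin 3) {n : ℕ} {X : DiffOp} (hX : X ∈ vanishingTop n) :
    deriv i * X ∈ vanishingTop (n + 1) := by
  obtain ⟨y, hy, z, hz, rfl⟩ := Submodule.mem_sup.1 hX
  rw [mul_add]
  refine add_mem ?_ (Submodule.mem_sup_right (deriv_mul_mem_orderLT i hz))
  clear hX
  induction hy using Submodule.smul_induction_on' with
  | smul p hp x hx =>
    rw [deriv_mul_poly_smul]
    exact add_mem
      (Submodule.mem_sup_left (Submodule.smul_mem_smul hp (deriv_mul_mem_orderLT i hx)))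
      (Submodule.mem_sup_right (Submodule.smul_mem _ _ hx))
  | add x _ y _ hx hy => rw [mul_add]; exact add_mem hx hy

theorem dmon_mul_mem_orderLT (γ : Fin 3 → ℕ) {n : ℕ} {X : DiffOp} (hX : X ∈ orderLT n) :
    dmon γ * X ∈ orderLT (∑ i, γ i + n) := by
  induction γ using multiindex_induction with
  | zero => simpa using hX
  | add_single γ i ih =>
    rw [← deriv_mul_dmon, mul_assoc, sum_add_single, add_right_comm]
    exact deriv_mul_mem_orderLT i ih

theorem dmon_mul_mem_vanishingTop (γ : Fin 3 → ℕ) {n : ℕ} {X : DiffOp}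
    (hX : X ∈ vanishingTop n) : dmon γ * X ∈ vanishingTop (∑ i, γ i + n) := by
  induction γ using multiindex_induction with
  | zero => simpa using hX
  | add_single γ i ih =>
    rw [← deriv_mul_dmon, mul_assoc, sum_add_single, add_right_comm]
    exact deriv_mul_mem_vanishingTop i ih

theorem mul_mem_orderLT {m n : ℕ} {X Y : DiffOp} (hX : X ∈ orderLT m) (hY : Y ∈ orderLT (n + 1)) :
    X * Y ∈ orderLT (m + n) := by
  induction hX using Submodule.span_induction with
  | mem x hx =>
    obtain ⟨γ, hγ, rfl⟩ := hx
    refine orderLT_mono ?_ (dmon_mul_mem_orderLT γ hY)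
    have : ∑ i, γ i < m := hγ
    omega
  | zero => simp
  | add x y _ _ hx hy => rw [add_mul]; exact add_mem hx hy
  | smul p x _ hx => rw [poly_smul_mul]; exact Submodule.smul_mem _ _ hx

theorem vanishingTop_mul {m n : ℕ} {X Y : DiffOp} (hX : X ∈ vanishingTop m)
    (hY : Y ∈ orderLT (n + 1)) : X * Y ∈ vanishingTop (m + n) := by
  obtain ⟨y, hy, z, hz, rfl⟩ := Submodule.mem_sup.1 hX
  rw [add_mul]
  refine add_mem ?_ (Submodule.mem_sup_right (mul_mem_orderLT hz hY))
  clear hX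
  induction hy using Submodule.smul_induction_on' with
  | smul p hp x hx =>
    rw [poly_smul_mul]
    refine Submodule.mem_sup_left (Submodule.smul_mem_smul hp ?_)
    rw [add_right_comm]
    exact mul_mem_orderLT hx hY
  | add x _ y _ hx hy => rw [add_mul]; exact add_mem hx hy

/-- The operator `X` has polynomial coefficients, and at the origin its part of order `|γ|`
is `∂^γ`, while there are no terms of larger order. -/
def HasLead (X : DiffOp) (γ : Fin 3 → ℕ) : Prop := X - dmon γ ∈ vanishingTop (∑ i, γ i)

theorem hasLead_dmon (γ : Fin 3 → ℕ) : HasLead (dmon γ) γ := by simp [HasLead]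

theorem HasLead.mem_orderLT {X : DiffOp} {γ : Fin 3 → ℕ} (h : HasLead X γ) :
    X ∈ orderLT (∑ i, γ i + 1) := by
  have := add_mem (vanishingTop_le _ h) (dmon_mem_orderLT (Nat.lt_succ_self (∑ i, γ i)))
  rwa [sub_add_cancel] at this

theorem HasLead.mul {X Y : DiffOp} {γ δ : Fin 3 → ℕ} (hX : HasLead X γ) (hY : HasLead Y δ) :
    HasLead (X * Y) (γ + δ) := by
  have h : X * Y - dmon (γ + δ) = (X - dmon γ) * Y + dmon γ * (Y - dmon δ) := by
    rw [← dmon_mul_dmon]; noncomm_ring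
  have hsum : ∑ i, (γ + δ) i = ∑ i, γ i + ∑ i, δ i := Finset.sum_add_distrib
  rw [HasLead, h, hsum]
  exact add_mem (vanishingTop_mul hX hY.mem_orderLT) (dmon_mul_mem_vanishingTop γ hY)

theorem HasLead.pow {X : DiffOp} {γ : Fin 3 → ℕ} (hX : HasLead X γ) (k : ℕ) :
    HasLead (X ^ k) (k • γ) := by
  induction k with
  | zero => simpa using hasLead_dmon 0
  | succ k ih => rw [pow_succ, succ_nsmul]; exact ih.mul hX

/-! ### Bases adapted to a system of three operators -/

/-- The operators `∂^α P₁^β₁ P₂^β₂ P₃^β₃`, where `γ = α + 2 β` and the entries of `α` are at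
most `1`. -/
def adapted (P : DiffSystem) (γ : Fin 3 → ℕ) : DiffOp :=
  dmon (fun i => γ i % 2) * (P 0 ^ (γ 0 / 2) * P 1 ^ (γ 1 / 2) * P 2 ^ (γ 2 / 2))

/-- At the origin, the top order part of `Pᵢ` is `∂ᵢ²`. -/
def LeadsSquares (P : DiffSystem) : Prop := ∀ i, HasLead (P i) (Pi.single i 2)

variable {P : DiffSystem}

theorem LeadsSquares.hasLead_adapted (hP : LeadsSquares P) (γ : Fin 3 → ℕ) :
    HasLead (adapted P γ) γ := by
  have h := (hasLead_dmon fun i => γ i % 2).mul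
    ((((hP 0).pow (γ 0 / 2)).mul ((hP 1).pow (γ 1 / 2))).mul ((hP 2).pow (γ 2 / 2)))
  have e : (fun i => γ i % 2) + ((γ 0 / 2) • Pi.single 0 2 + (γ 1 / 2) • Pi.single 1 2 +
      (γ 2 / 2) • Pi.single 2 2) = γ := by
    funext i
    fin_cases i <;> simp <;> omega
  rwa [e] at h

/-- The hypothesis of Nakayama's lemma for `LeadsSquares.span_le`. -/
theorem LeadsSquares.orderLT_le (hP : LeadsSquares P) (n : ℕ) :
    orderLT n ≤ Submodule.span Poly (adapted P '' {γ | ∑ i, γ i < n}) ⊔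
      originIdeal • orderLT n := by
  induction n with
  | zero => simp [orderLT]
  | succ n ih =>
    conv_lhs => rw [orderLT]
    rw [Submodule.span_le]
    rintro _ ⟨γ, hγ, rfl⟩
    have hγ' : ∑ i, γ i ≤ n := Nat.lt_succ_iff.1 hγ
    rw [← sub_sub_self (adapted P γ) (dmon γ)]
    refine sub_mem (Submodule.mem_sup_left (Submodule.subset_span ⟨γ, hγ, rfl⟩)) ?_
    refine (sup_le ?_ ?_ : vanishingTop (∑ i, γ i) ≤ _) (hP.hasLead_adapted γ)
    · exact le_sup_of_le_right (Submodule.smul_mono le_rfl (orderLT_mono (by omega)))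
    · refine (orderLT_mono hγ').trans (ih.trans (sup_le_sup ?_ ?_))
      · exact Submodule.span_mono (Set.image_mono fun δ hδ => Nat.lt_succ_of_lt hδ)
      · exact Submodule.smul_mono le_rfl (orderLT_mono n.le_succ)

theorem finite_multiindex (n : ℕ) : {γ : Fin 3 → ℕ | ∑ i, γ i < n}.Finite := by
  refine (Set.finite_Iic fun _ => n).subset fun γ hγ i => ?_
  have : γ i ≤ ∑ i, γ i := Finset.single_le_sum (fun _ _ => Nat.zero_le _) (Finset.mem_univ i)
  exact this.trans (le_of_lt hγ)

/-- By Nakayama's lemma at the origin, the adapted operators span the operators of bounded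
order. -/
theorem LeadsSquares.span_le (hP : LeadsSquares P) (n : ℕ) :
    Submodule.span RatField (dmon '' {γ | ∑ i, γ i < n}) ≤
      Submodule.span RatField (adapted P '' {γ | ∑ i, γ i < n}) := by
  obtain ⟨r, hr, hle⟩ := Submodule.exists_sub_one_mem_and_smul_le_of_fg_of_le_sup
    (Submodule.fg_span ((finite_multiindex n).image _)) le_rfl (hP.orderLT_le n)
  have hr0 : algebraMap Poly RatField r ≠ 0 := by
    rw [Ne, map_eq_zero_iff _ (IsFractionRing.injective _ _)]
    rintro rfl
    simp [originIdeal, RingHom.mem_ker] at hr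
  rw [Submodule.span_le]
  rintro _ ⟨γ, hγ, rfl⟩
  have h := hle (Submodule.smul_mem_pointwise_smul _ r _ (dmon_mem_orderLT hγ))
  have h' := Submodule.span_le_restrictScalars Poly RatField _ h
  rw [Submodule.restrictScalars_mem, poly_smul_eq] at h'
  exact (Submodule.smul_mem_iff _ hr0).1 h'

theorem LeadsSquares.span_adapted (hP : LeadsSquares P) :
    Submodule.span RatField (Set.range (adapted P)) = ⊤ := by
  rw [eq_top_iff, ← span_dmon, Submodule.span_le]
  rintro _ ⟨γ, rfl⟩
  exact Submodule.span_mono (Set.image_subset_range _ _) (hP.span_le (∑ i, γ i + 1)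
    (Submodule.subset_span ⟨γ, Nat.lt_succ_self _, rfl⟩))

/-- The adapted operators of bounded order span a space of dimension at least their number, so
they are independent. -/
theorem LeadsSquares.linearIndependent_adapted (hP : LeadsSquares P) :
    LinearIndependent RatField (adapted P) := by
  have key : ∀ n, LinearIndependent RatField
      (fun γ : {γ : Fin 3 → ℕ | ∑ i, γ i < n} => adapted P γ) := by
    intro n
    have := (finite_multiindex n).fintype
    have hfin := (finite_multiindex n).image (adapted P)
    rw [linearIndependent_iff_card_le_finrank_span]
    have hd : LinearIndependent RatField
        (fun γ : {γ : Fin 3 → ℕ | ∑ i, γ i < n} => dmon γ) :=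
      linearIndependent_dmon.comp _ Subtype.val_injective
    rw [linearIndependent_iff_card_eq_finrank_span.1 hd, Set.finrank, Set.finrank,
      ← Set.image_eq_range, ← Set.image_eq_range]
    have := FiniteDimensional.span_of_finite RatField hfin
    exact Submodule.finrank_mono (hP.span_le n)
  rw [linearIndependent_iff_finset_linearIndependent]
  intro s
  obtain ⟨n, hn⟩ : ∃ n, ∀ γ ∈ s, ∑ i, γ i < n :=
    ⟨s.sup (fun γ => ∑ i, γ i) + 1, fun γ hγ =>
      Nat.lt_succ_of_le (Finset.le_sup (f := fun γ : Fin 3 → ℕ => ∑ i, γ i) hγ)⟩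
  exact (key n).comp (fun γ : s => ⟨γ.1, hn γ.1 γ.2⟩) fun x y h =>
    Subtype.ext (congrArg (fun z => z.1) h)

/-- The basis `∂^α P₁^β₁ P₂^β₂ P₃^β₃` of the ring of differential operators. -/
def LeadsSquares.basis (hP : LeadsSquares P) : Module.Basis (Fin 3 → ℕ) RatField DiffOp :=
  Module.Basis.mk hP.linearIndependent_adapted hP.span_adapted.ge

/-! ### The rank of a system whose leading part is `∂₁², ∂₂², ∂₃²` at the origin -/

/-- The span of the adapted operators that involve some `Pᵢ`. -/
def adaptedSpan (P : DiffSystem) : Submodule RatField DiffOp :=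
  Submodule.span RatField (adapted P '' {γ | ∃ i, 2 ≤ γ i})

theorem mul_pow_mem_ideal (X : DiffOp) {a b c : ℕ} (h : a ≠ 0 ∨ b ≠ 0 ∨ c ≠ 0) :
    X * (P 0 ^ a * P 1 ^ b * P 2 ^ c) ∈ P.ideal := by
  have hP : ∀ (Y : DiffOp) i, Y * P i ∈ P.ideal := fun Y i =>
    P.ideal.smul_mem Y (Submodule.subset_span ⟨i, rfl⟩)
  rcases c with _ | c
  · rcases b with _ | b
    · rcases a with _ | a
      · simp at h
      · simpa [pow_succ, ← mul_assoc] using hP _ 0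
    · simpa [pow_succ, ← mul_assoc] using hP _ 1
  · simpa [pow_succ, ← mul_assoc] using hP _ 2

theorem adaptedSpan_le (P : DiffSystem) : adaptedSpan P ≤ P.ideal.restrictScalars RatField := by
  rw [adaptedSpan, Submodule.span_le]
  rintro _ ⟨γ, ⟨i, hi⟩, rfl⟩
  apply mul_pow_mem_ideal
  fin_cases i <;> simp at hi <;> omega

theorem adapted_mul (hcomm : ∀ i j, Commute (P i) (P j)) (γ : Fin 3 → ℕ) (i : Fin 3) :
    adapted P γ * P i = adapted P (γ + Pi.single i 2) := by
  have hmod : (fun j => (γ + Pi.single i 2 : Fin 3 → ℕ) j % 2) = fun j => γ j % 2 := by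
    funext j
    by_cases h : j = i
    · subst h; simp
    · simp [h]
  rw [adapted, adapted, hmod, mul_assoc]
  congr 1
  have h20 := ((hcomm 0 2).pow_right (γ 2 / 2)).eq
  have h21 := ((hcomm 1 2).pow_right (γ 2 / 2)).eq
  have h10 := ((hcomm 0 1).pow_right (γ 1 / 2)).eq
  fin_cases i
  · simp only [Fin.zero_eta, Pi.add_apply, Pi.single_eq_same, mul_assoc, ← h20]
    simp only [← mul_assoc (P 1 ^ (γ 1 / 2)) (P 0), ← h10]
    simp [pow_succ, mul_assoc]
  · simp only [Fin.mk_one, Pi.add_apply, Pi.single_eq_same, mul_assoc, ← h21]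
    simp [pow_succ, mul_assoc]
  · simp [pow_succ, mul_assoc]

/-- If the `Pᵢ` commute, multiplication by `Pᵢ` from the right sends adapted operators to
adapted operators, and every operator is a combination of adapted ones. -/
theorem LeadsSquares.ideal_le (hP : LeadsSquares P) (hcomm : ∀ i j, Commute (P i) (P j)) :
    P.ideal.restrictScalars RatField ≤ adaptedSpan P := by
  have key : ∀ i X, X * P i ∈ adaptedSpan P := by
    intro i X
    have hX : X ∈ Submodule.span RatField (Set.range (adapted P)) := by
      rw [hP.span_adapted]; exact Submodule.mem_top
    induction hX using Submodule.span_induction with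
    | mem x hx =>
      obtain ⟨γ, rfl⟩ := hx
      rw [adapted_mul hcomm]
      exact Submodule.subset_span ⟨_, ⟨i, by simp⟩, rfl⟩
    | zero => simp
    | add x y _ _ hx hy => rw [add_mul]; exact add_mem hx hy
    | smul f x _ hx => rw [smul_mul_assoc]; exact Submodule.smul_mem _ _ hx
  intro X hX
  obtain ⟨c, rfl⟩ := (Submodule.mem_span_range_iff_exists_fun DiffOp).1 hX
  exact sum_mem fun i _ => key i (c i)

/-- The adapted operators that involve no `Pᵢ` are the eight squarefree monomials in the
derivations. -/
theorem LeadsSquares.rank_quotient (hP : LeadsSquares P) :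
    Module.rank RatField (DiffOp ⧸ adaptedSpan P) = 8 := by
  have hc : IsCompl (adaptedSpan P)
      (Submodule.span RatField (adapted P '' {γ | ∃ i, 2 ≤ γ i}ᶜ)) :=
    hP.linearIndependent_adapted.isCompl_span_image hP.span_adapted isCompl_compl
  rw [(Submodule.quotientEquivOfIsCompl _ _ hc).rank_eq,
    rank_span_set (hP.linearIndependent_adapted.linearIndepOn_id.mono
      (Set.image_subset_range _ _)),
    Cardinal.mk_image_eq hP.linearIndependent_adapted.injective]
  let e : ({γ : Fin 3 → ℕ | ∃ i, 2 ≤ γ i}ᶜ : Set _) ≃ (Fin 3 → Fin 2) :=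
    { toFun := fun γ i => ⟨γ.1 i, by
        have := γ.2
        simp only [Set.mem_compl_iff, Set.mem_ofPred_eq, not_exists, not_le] at this
        exact this i⟩
      invFun := fun γ => ⟨fun i => γ i, by simpa using fun i => Nat.le_of_lt_succ (γ i).2⟩
      left_inv := fun γ => rfl
      right_inv := fun γ => rfl }
  rw [Cardinal.mk_congr e]
  simp

/-- The rank is at most `8`, because the ideal always contains `adaptedSpan P`, and it is `8` exactly
when the two agree. -/
theorem LeadsSquares.rank_eq_iff (hP : LeadsSquares P) :
    P.rank = 8 ↔ P.ideal.restrictScalars RatField ≤ adaptedSpan P := by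
  have hrank : P.rank = Module.rank RatField (DiffOp ⧸ P.ideal.restrictScalars RatField) :=
    (Submodule.Quotient.restrictScalarsEquiv RatField P.ideal).rank_eq.symm
  constructor
  · intro h8 X hX
    have h1 : Module.finrank RatField (DiffOp ⧸ adaptedSpan P) = 8 :=
      Module.finrank_eq_of_rank_eq (by simpa using hP.rank_quotient)
    have h2 : Module.finrank RatField (DiffOp ⧸ P.ideal.restrictScalars RatField) = 8 :=
      Module.finrank_eq_of_rank_eq (by rw [← hrank, h8]; simp)
    have := Module.finite_of_finrank_pos
      (h1 ▸ Nat.succ_pos 7 : 0 < Module.finrank RatField (DiffOp ⧸ adaptedSpan P))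
    have := Module.finite_of_finrank_pos
      (h2 ▸ Nat.succ_pos 7 : 0 <
        Module.finrank RatField (DiffOp ⧸ P.ideal.restrictScalars RatField))
    have hinj := (LinearMap.injective_iff_surjective_of_finrank_eq_finrank (h1.trans h2.symm)).2
      (Submodule.factor_surjective (adaptedSpan_le P))
    rw [← Submodule.Quotient.mk_eq_zero]
    apply hinj
    rw [map_zero]
    exact (Submodule.Quotient.mk_eq_zero _).2 hX
  · intro hle
    rw [hrank, le_antisymm hle (adaptedSpan_le P), hP.rank_quotient]

theorem adapted_single (P : DiffSystem) (i : Fin 3) : adapted P (Pi.single i 2) = P i := by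
  have hmod : (fun j => (Pi.single i 2 : Fin 3 → ℕ) j % 2) = 0 := by
    funext j
    by_cases h : j = i
    · subst h; simp
    · simp [h]
  rw [adapted, hmod]
  fin_cases i <;> simp

/-- If the rank is `8`, the operators of order at most `2` in the ideal are combinations of the
three generators. -/
theorem LeadsSquares.exists_eq_sum (hP : LeadsSquares P) (h8 : P.rank = 8) {X : DiffOp}
    (hX : X ∈ P.ideal) (hord : X ∈ Submodule.span RatField (dmon '' {γ | ∑ i, γ i < 3})) :
    ∃ d : Fin 3 → RatField, ∑ i, d i • P i = X := by
  have h1 := hP.rank_eq_iff.1 h8 hX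
  have h2 := hP.span_le 3 hord
  have hb : ⇑hP.basis = adapted P := Module.Basis.coe_mk _ _
  rw [adaptedSpan, ← hb, Module.Basis.mem_span_image] at h1
  rw [← hb, Module.Basis.mem_span_image] at h2
  rw [← Submodule.mem_span_range_iff_exists_fun]
  refine Submodule.span_mono ?_ ((Module.Basis.mem_span_image _).2 (Set.subset_inter h1 h2))
  rintro _ ⟨γ, ⟨⟨i, hi⟩, hγ⟩, rfl⟩
  have hγ' : ∑ i, γ i < 3 := hγ
  rw [Fin.sum_univ_three] at hγ'
  refine ⟨i, ?_⟩
  rw [hb, ← adapted_single P i]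
  congr 1
  funext j
  fin_cases i <;> fin_cases j <;> simp at hi ⊢ <;> omega

theorem ideal_eq_of_mem {P Q : DiffSystem} (hQ : ∀ i, Q i ∈ P.ideal) (hP : ∀ i, P i ∈ Q.ideal) :
    Q.ideal = P.ideal :=
  le_antisymm (Submodule.span_le.2 (Set.range_subset_iff.2 hQ))
    (Submodule.span_le.2 (Set.range_subset_iff.2 hP))

/-! ### The commutators -/

/-- The commutator of two operators of the shape of `E₁`, `E₂`, for three commuting derivations.
All terms of order `3` and `4` cancel, and the result is linear in the coefficients. -/
theorem commutator_derivation {R : Type*} [CommRing R] [Algebra ℂ R] (d₁ d₂ d₃ : Derivation ℂ R R)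
    (h₂₁ : ∀ f, d₂ (d₁ f) = d₁ (d₂ f)) (h₃₁ : ∀ f, d₃ (d₁ f) = d₁ (d₃ f))
    (h₃₂ : ∀ f, d₃ (d₂ f) = d₂ (d₃ f)) (x y z : R)
    (hx₁ : d₁ x = 1) (hx₂ : d₂ x = 0) (hx₃ : d₃ x = 0)
    (hy₁ : d₁ y = 0) (hy₂ : d₂ y = 1) (hy₃ : d₃ y = 0)
    (hz₁ : d₁ z = 0) (hz₂ : d₂ z = 0) (hz₃ : d₃ z = 1)
    (a₁ a₂ a₃ a₀ b₁ b₂ b₃ b₀ : ℂ) (E F : R → R)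
    (hE : ∀ f, E f = (1 - y ^ 2) * d₂ (d₂ f) + 2 * (x - y * z) * d₂ (d₃ f)
      + (1 - z ^ 2) * d₃ (d₃ f) + algebraMap ℂ R a₁ * (x * d₁ f) + algebraMap ℂ R a₂ * (y * d₂ f)
      + algebraMap ℂ R a₃ * (z * d₃ f) + algebraMap ℂ R a₀ * f)
    (hF : ∀ f, F f = (1 - z ^ 2) * d₃ (d₃ f) + 2 * (y - z * x) * d₁ (d₃ f)
      + (1 - x ^ 2) * d₁ (d₁ f) + algebraMap ℂ R b₁ * (x * d₁ f) + algebraMap ℂ R b₂ * (y * d₂ f)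
      + algebraMap ℂ R b₃ * (z * d₃ f) + algebraMap ℂ R b₀ * f) (f : R) :
    E (F f) - F (E f) = 2 * (algebraMap ℂ R b₂ * d₂ (d₂ f) - algebraMap ℂ R a₁ * d₁ (d₁ f)
      + algebraMap ℂ R (b₃ - a₃) * d₃ (d₃ f)
      + algebraMap ℂ R (b₂ + b₃ - b₁) * (x * d₂ (d₃ f))
      - algebraMap ℂ R (a₁ + a₃ - a₂) * (y * d₁ (d₃ f))) := by
  have h2 : ∀ d : Derivation ℂ R R, d 2 = 0 := fun d => by
    simpa using d.map_natCast 2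
  simp only [hE, hF, map_add, map_sub, Derivation.leibniz, smul_eq_mul, h₂₁, h₃₁, h₃₂, hx₁, hx₂,
    hx₃, hy₁, hy₂, hy₃, hz₁, hz₂, hz₃, pow_two, Derivation.map_algebraMap,
    Derivation.map_one_eq_zero, h2, mul_one, mul_zero, add_zero, zero_add, zero_sub,
    sub_zero, map_neg]
  ring

/-- If a differential operator of second order acts as zero, the coefficients of its terms of
order `2` are zero. -/
theorem coefficients_eq_zero {R : Type*} [Field R] [Algebra ℂ R] (d₁ d₂ d₃ : Derivation ℂ R R)
    (x y z : R)
    (hx₁ : d₁ x = 1) (hx₂ : d₂ x = 0) (hx₃ : d₃ x = 0)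
    (hy₁ : d₁ y = 0) (hy₂ : d₂ y = 1) (hy₃ : d₃ y = 0)
    (hz₁ : d₁ z = 0) (hz₂ : d₂ z = 0) (hz₃ : d₃ z = 1)
    (c₁₁ c₂₂ c₃₃ c₁₂ c₁₃ c₂₃ e₁ e₂ e₃ e₀ : R)
    (h : ∀ f, c₁₁ * d₁ (d₁ f) + c₂₂ * d₂ (d₂ f) + c₃₃ * d₃ (d₃ f) + c₁₂ * d₁ (d₂ f)
      + c₁₃ * d₁ (d₃ f) + c₂₃ * d₂ (d₃ f) + e₁ * d₁ f + e₂ * d₂ f + e₃ * d₃ f + e₀ * f = 0) :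
    c₁₁ = 0 ∧ c₂₂ = 0 ∧ c₃₃ = 0 ∧ c₁₂ = 0 ∧ c₁₃ = 0 ∧ c₂₃ = 0 := by
  have : CharZero R := charZero_of_injective_algebraMap (algebraMap ℂ R).injective
  have h0 := h 1
  have hx := h x
  have hy := h y
  have hz := h z
  have hxx := h (x * x)
  have hyy := h (y * y)
  have hzz := h (z * z)
  have hxy := h (x * y)
  have hxz := h (x * z)
  have hyz := h (y * z)
  simp only [map_add, Derivation.leibniz, smul_eq_mul, hx₁, hx₂, hx₃, hy₁, hy₂, hy₃, hz₁, hz₂,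
    hz₃, Derivation.map_one_eq_zero, map_zero, mul_one, mul_zero, add_zero, zero_add]
    at h0 hx hy hz hxx hyy hzz hxy hxz hyz
  refine ⟨?_, ?_, ?_, ?_, ?_, ?_⟩
  · linear_combination (hxx - 2 * x * hx + x * x * h0) / 2
  · linear_combination (hyy - 2 * y * hy + y * y * h0) / 2
  · linear_combination (hzz - 2 * z * hz + z * z * h0) / 2
  · linear_combination hxy - x * hy - y * hx + x * y * h0
  · linear_combination hxz - x * hz - z * hx + x * z * h0
  · linear_combination hyz - y * hz - z * hy + y * z * h0

/-! ### The systems `E` -/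

@[simp]
theorem action_algebraMap (c : ℂ) (g : RatField) :
    action (algebraMap ℂ DiffOp c) g = algebraMap ℂ RatField c * g := by
  rw [← coeff.commutes, action_coeff]

@[simp]
theorem action_poly_smul (p : Poly) (X : DiffOp) (g : RatField) :
    action (p • X) g = algebraMap Poly RatField p * action X g :=
  action_smul _ _ _

theorem add_one_add_one (i : Fin 3) : i + 1 + 1 = i + 2 := by fin_cases i <;> rfl

theorem add_one_add_two (i : Fin 3) : i + 1 + 2 = i := by fin_cases i <;> rfl

theorem add_two_add_one (i : Fin 3) : i + 2 + 1 = i := by fin_cases i <;> rfl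

theorem add_two_add_two (i : Fin 3) : i + 2 + 2 = i + 1 := by fin_cases i <;> rfl

theorem sum_cyclic {M : Type*} [AddCommMonoid M] (g : Fin 3 → M) (i : Fin 3) :
    ∑ l, g l = g i + g (i + 1) + g (i + 2) := by
  rw [Fin.sum_univ_three]
  fin_cases i
  · rfl
  · change g 0 + g 1 + g 2 = g 1 + g 2 + g 0
    abel
  · change g 0 + g 1 + g 2 = g 2 + g 0 + g 1
    abel

variable (a : Fin 3 → Fin 3 → ℂ) (b : Fin 3 → ℂ)

theorem action_E (i : Fin 3) (f : RatField) : action (E a b i) f =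
    (1 - tvar (i + 1) ^ 2) * partialDer (i + 1) (partialDer (i + 1) f)
      + 2 * (tvar i - tvar (i + 1) * tvar (i + 2)) * partialDer (i + 1) (partialDer (i + 2) f)
      + (1 - tvar (i + 2) ^ 2) * partialDer (i + 2) (partialDer (i + 2) f)
      + algebraMap ℂ RatField (a i i) * (tvar i * partialDer i f)
      + algebraMap ℂ RatField (a i (i + 1)) * (tvar (i + 1) * partialDer (i + 1) f)
      + algebraMap ℂ RatField (a i (i + 2)) * (tvar (i + 2) * partialDer (i + 2) f)
      + algebraMap ℂ RatField (b i) * f := by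
  have h2 : (2 : DiffOp) = algebraMap ℂ DiffOp 2 := (map_ofNat _ 2).symm
  rw [E, sum_cyclic _ i, principalPart, h2]
  simp only [map_add, map_mul, map_sub, pow_two, map_one, LinearMap.add_apply,
    LinearMap.sub_apply, Module.End.mul_apply, Module.End.one_apply, action_algebraMap,
    action_deriv, t, action_coeff]
  rw [map_ofNat]
  ring

theorem partialDer_tvar_self (i : Fin 3) : partialDer i (tvar i) = 1 := by
  rw [partialDer_tvar, if_pos rfl]

theorem partialDer_tvar_of_ne {i j : Fin 3} (h : i ≠ j) : partialDer i (tvar j) = 0 := by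
  rw [partialDer_tvar, if_neg h]

theorem ne_cyclic (i : Fin 3) : i ≠ i + 1 ∧ i ≠ i + 2 ∧ i + 1 ≠ i + 2 := by
  fin_cases i <;> decide

theorem commutator_E (i : Fin 3) :
    E a b i * E a b (i + 1) - E a b (i + 1) * E a b i =
      algebraMap ℂ RatField (2 * a (i + 1) (i + 1)) • (deriv (i + 1) * deriv (i + 1))
      - algebraMap ℂ RatField (2 * a i i) • (deriv i * deriv i)
      + algebraMap ℂ RatField (2 * (a (i + 1) (i + 2) - a i (i + 2))) •
        (deriv (i + 2) * deriv (i + 2))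
      + (algebraMap ℂ RatField (2 * (a (i + 1) (i + 1) + a (i + 1) (i + 2) - a (i + 1) i)) *
        tvar i) • (deriv (i + 1) * deriv (i + 2))
      - (algebraMap ℂ RatField (2 * (a i i + a i (i + 2) - a i (i + 1))) * tvar (i + 1)) •
        (deriv i * deriv (i + 2)) := by
  obtain ⟨h1, h2, h3⟩ := ne_cyclic i
  apply action_injective
  ext f
  have := commutator_derivation (partialDer i) (partialDer (i + 1)) (partialDer (i + 2))
    (partialDer_comm _ _) (partialDer_comm _ _) (partialDer_comm _ _)
    (tvar i) (tvar (i + 1)) (tvar (i + 2))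
    (partialDer_tvar_self _) (partialDer_tvar_of_ne h1.symm) (partialDer_tvar_of_ne h2.symm)
    (partialDer_tvar_of_ne h1) (partialDer_tvar_self _) (partialDer_tvar_of_ne h3.symm)
    (partialDer_tvar_of_ne h2) (partialDer_tvar_of_ne h3) (partialDer_tvar_self _)
    (a i i) (a i (i + 1)) (a i (i + 2)) (b i)
    (a (i + 1) i) (a (i + 1) (i + 1)) (a (i + 1) (i + 2)) (b (i + 1))
    (fun f => action (E a b i) f) (fun f => action (E a b (i + 1)) f)
    (fun f => by rw [action_E])
    (fun f => by
      rw [action_E, add_one_add_one, add_one_add_two, partialDer_comm (i + 2) i]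
      ring) f
  rw [map_sub, map_mul, map_mul, LinearMap.sub_apply, Module.End.mul_apply, Module.End.mul_apply,
    this]
  simp only [map_add, map_sub, map_mul, LinearMap.add_apply, LinearMap.sub_apply, action_smul,
    Module.End.mul_apply, action_deriv, map_ofNat]
  ring

/-- The generators `(Eⱼ + Eₖ - Eᵢ) / 2` of the ideal of the system `E`; the leading part at the
origin is `∂ᵢ²`, whereas that of `Eᵢ` is `∂ⱼ² + ∂ₖ²`. -/
def diagonalE : DiffSystem := fun i =>
  (1 / 2 : ℂ) • (E a b (i + 1) + E a b (i + 2) - E a b i)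

theorem E_eq_diagonalE_add (i : Fin 3) :
    E a b i = diagonalE a b (i + 1) + diagonalE a b (i + 2) := by
  simp only [diagonalE, add_one_add_one, add_one_add_two, add_two_add_one, add_two_add_two]
  module

theorem E_mem_ideal (i : Fin 3) : E a b i ∈ (E a b).ideal := Submodule.subset_span ⟨i, rfl⟩

theorem ideal_diagonalE : (diagonalE a b).ideal = (E a b).ideal := by
  apply ideal_eq_of_mem
  · intro i
    rw [diagonalE, Algebra.smul_def]
    exact Submodule.smul_mem _ _
      (sub_mem (add_mem (E_mem_ideal a b _) (E_mem_ideal a b _)) (E_mem_ideal a b _))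
  · intro i
    rw [E_eq_diagonalE_add]
    exact add_mem (Submodule.subset_span ⟨_, rfl⟩) (Submodule.subset_span ⟨_, rfl⟩)

theorem rank_diagonalE : (diagonalE a b).rank = (E a b).rank := by
  rw [DiffSystem.rank, DiffSystem.rank, ideal_diagonalE]

theorem dmon_single (i : Fin 3) (k : ℕ) : dmon (Pi.single i k) = deriv i ^ k := by
  fin_cases i <;> simp [dmon]

theorem dmon_single_add_single (i j : Fin 3) :
    dmon (Pi.single i 1 + Pi.single j 1) = deriv i * deriv j := by
  rw [← dmon_mul_dmon, dmon_single, dmon_single, pow_one, pow_one]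

/-- At the origin, the part of order `2` of `Eᵢ` is `∂ⱼ² + ∂ₖ²`. -/
theorem E_sub_mem_vanishingTop (i : Fin 3) :
    E a b i - deriv (i + 1) ^ 2 - deriv (i + 2) ^ 2 ∈ vanishingTop 2 := by
  have h : E a b i - deriv (i + 1) ^ 2 - deriv (i + 2) ^ 2 =
      ((-X (i + 1) ^ 2 : Poly) • dmon (Pi.single (i + 1) 2)
        + (2 * (X i - X (i + 1) * X (i + 2)) : Poly) •
          dmon (Pi.single (i + 1) 1 + Pi.single (i + 2) 1)
        + (-X (i + 2) ^ 2 : Poly) • dmon (Pi.single (i + 2) 2))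
      + ((C (a i i) * X i : Poly) • dmon (Pi.single i 1)
        + (C (a i (i + 1)) * X (i + 1) : Poly) • dmon (Pi.single (i + 1) 1)
        + (C (a i (i + 2)) * X (i + 2) : Poly) • dmon (Pi.single (i + 2) 1)
        + (C (b i) : Poly) • dmon 0) := by
    have hC : ∀ c, algebraMap Poly RatField (C c) = algebraMap ℂ RatField c := fun c =>
      (IsScalarTower.algebraMap_apply ℂ Poly RatField c).symm
    have hX : ∀ l, algebraMap Poly RatField (X l) = tvar l := fun l => rfl
    apply action_injective
    ext f
    simp only [map_sub, map_add, LinearMap.add_apply, LinearMap.sub_apply, action_E,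
      action_poly_smul, dmon_single, dmon_single_add_single, dmon_zero, map_mul, map_neg,
      map_one, pow_two, pow_one, map_ofNat, hC, hX, Module.End.mul_apply, Module.End.one_apply,
      action_deriv]
    ring
  have h2 : ∀ (p : Poly) (γ : Fin 3 → ℕ), p ∈ originIdeal → ∑ l, γ l = 2 →
      p • dmon γ ∈ vanishingTop 2 := fun p γ hp hγ =>
    Submodule.mem_sup_left (Submodule.smul_mem_smul hp (dmon_mem_orderLT (by omega)))
  have h1 : ∀ (p : Poly) (γ : Fin 3 → ℕ), ∑ l, γ l < 2 → p • dmon γ ∈ vanishingTop 2 :=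
    fun p γ hγ => Submodule.mem_sup_right (Submodule.smul_mem _ _ (dmon_mem_orderLT hγ))
  have hs : ∀ l : Fin 3, ∑ m, (Pi.single l 1 : Fin 3 → ℕ) m < 2 := by simp
  rw [h]
  refine add_mem (add_mem (add_mem (h2 _ _ ?_ ?_) (h2 _ _ ?_ ?_)) (h2 _ _ ?_ ?_))
    (add_mem (add_mem (add_mem (h1 _ _ (hs _)) (h1 _ _ (hs _))) (h1 _ _ (hs _)))
      (h1 _ _ (by simp)))
  all_goals simp [originIdeal, RingHom.mem_ker, Finset.sum_add_distrib]

theorem complex_smul_eq (c : ℂ) (X : DiffOp) : c • X = (C c : Poly) • X := by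
  have hC : algebraMap Poly RatField (C c) = algebraMap ℂ RatField c :=
    (IsScalarTower.algebraMap_apply ℂ Poly RatField c).symm
  rw [poly_smul_eq, hC, smul_eq_coeff_mul, coeff.commutes, Algebra.smul_def]

theorem leadsSquares_diagonalE : LeadsSquares (diagonalE a b) := by
  intro i
  have h : diagonalE a b i - dmon (Pi.single i 2) = (C (1 / 2) : Poly) •
      ((E a b (i + 1) - deriv (i + 2) ^ 2 - deriv i ^ 2)
        + (E a b (i + 2) - deriv i ^ 2 - deriv (i + 1) ^ 2)
        - (E a b i - deriv (i + 1) ^ 2 - deriv (i + 2) ^ 2)) := by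
    rw [← complex_smul_eq, diagonalE, dmon_single]
    module
  have h1 := E_sub_mem_vanishingTop a b (i + 1)
  have h2 := E_sub_mem_vanishingTop a b (i + 2)
  rw [add_one_add_one, add_one_add_two] at h1
  rw [add_two_add_one, add_two_add_two] at h2
  rw [HasLead, h]
  simp only [Finset.sum_pi_single', Finset.mem_univ, if_true]
  exact Submodule.smul_mem _ _ (sub_mem (add_mem h1 h2) (E_sub_mem_vanishingTop a b i))

theorem commute_E (h0 : ∀ i, a i i = 0) {a₀ : ℂ} (ha : ∀ i j, i ≠ j → a i j = a₀) (i j : Fin 3) :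
    Commute (E a b i) (E a b j) := by
  have key : ∀ i, Commute (E a b i) (E a b (i + 1)) := by
    intro i
    obtain ⟨h1, h2, h3⟩ := ne_cyclic i
    rw [commute_iff_eq, ← sub_eq_zero, commutator_E, h0, h0, ha _ _ h1, ha _ _ h2, ha _ _ h3,
      ha _ _ h1.symm]
    simp
  obtain rfl | rfl | rfl : j = i ∨ j = i + 1 ∨ j = i + 2 := by
    fin_cases i <;> fin_cases j <;> simp
  · exact Commute.refl _
  · exact key i
  · have := (key (i + 2)).symm
    rwa [add_two_add_one] at this

theorem rank_E_of_eq (h0 : ∀ i, a i i = 0) {a₀ : ℂ} (ha : ∀ i j, i ≠ j → a i j = a₀) :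
    (E a b).rank = 8 := by
  rw [← rank_diagonalE, (leadsSquares_diagonalE a b).rank_eq_iff]
  apply (leadsSquares_diagonalE a b).ideal_le
  intro i j
  have h := commute_E a b h0 ha
  exact (((((h _ _).add_right (h _ _)).sub_right (h _ _)).add_left
    (((h _ _).add_right (h _ _)).sub_right (h _ _))).sub_left
    (((h _ _).add_right (h _ _)).sub_right (h _ _))).smul_left _ |>.smul_right _

/-- Substitution of values for the variables, in a relation between polynomials that holds in the
field of rational functions. -/
theorem eval_eq_of_algebraMap_eq {p q : Poly}
    (h : algebraMap Poly RatField p = algebraMap Poly RatField q) (v : Fin 3 → ℂ) :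
    eval v p = eval v q :=
  congrArg (eval v) (IsFractionRing.injective Poly RatField h)

/-! ### Necessity of the conditions -/

theorem action_diagonalE (i : Fin 3) (f : RatField) : action (diagonalE a b i) f =
    (action (E a b (i + 1)) f + action (E a b (i + 2)) f - action (E a b i) f) / 2 := by
  rw [diagonalE, map_smul, map_sub, map_add, LinearMap.smul_apply, LinearMap.sub_apply,
    LinearMap.add_apply, Algebra.smul_def, map_div₀, map_one, map_ofNat]
  ring

theorem commutator_E_mem_span (i : Fin 3) :
    E a b i * E a b (i + 1) - E a b (i + 1) * E a b i ∈
      Submodule.span RatField (dmon '' {γ | ∑ l, γ l < 3}) := by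
  have h : ∀ (f : RatField) (l m : Fin 3), f • (deriv l * deriv m) ∈
      Submodule.span RatField (dmon '' {γ | ∑ l, γ l < 3}) := fun f l m => by
    rw [← dmon_single_add_single]
    exact Submodule.smul_mem _ _ (Submodule.subset_span
      ⟨_, by simp [Finset.sum_add_distrib], rfl⟩)
  rw [commutator_E]
  exact sub_mem (add_mem (add_mem (sub_mem (h _ _ _) (h _ _ _)) (h _ _ _)) (h _ _ _)) (h _ _ _)

/-- The commutator of `Eᵢ` and `Eⱼ` has order at most `2`. If the rank is `8` it is a combination
of the generators with rational coefficients, which a comparison of symbols turns into these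
relations. -/
theorem exists_symbol_relations (h8 : (E a b).rank = 8) (i : Fin 3) :
    ∃ p q r : RatField,
      p * (1 - tvar i ^ 2) = -algebraMap ℂ RatField (2 * a i i) ∧
      q * (1 - tvar (i + 1) ^ 2) = algebraMap ℂ RatField (2 * a (i + 1) (i + 1)) ∧
      r * (1 - tvar (i + 2) ^ 2) =
        algebraMap ℂ RatField (2 * (a (i + 1) (i + 2) - a i (i + 2))) ∧
      (tvar (i + 2) - tvar i * tvar (i + 1)) * (p + q - r) = 0 ∧
      (tvar (i + 1) - tvar (i + 2) * tvar i) * (p + r - q) =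
        -(algebraMap ℂ RatField (2 * (a i i + a i (i + 2) - a i (i + 1))) * tvar (i + 1)) ∧
      (tvar i - tvar (i + 1) * tvar (i + 2)) * (q + r - p) =
        algebraMap ℂ RatField (2 * (a (i + 1) (i + 1) + a (i + 1) (i + 2) - a (i + 1) i)) *
          tvar i := by
  obtain ⟨h1, h2, h3⟩ := ne_cyclic i
  have hmem : E a b i * E a b (i + 1) - E a b (i + 1) * E a b i ∈ (diagonalE a b).ideal := by
    rw [ideal_diagonalE]
    exact sub_mem (Submodule.smul_mem _ _ (E_mem_ideal a b _))
      (Submodule.smul_mem _ _ (E_mem_ideal a b _))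
  obtain ⟨d, hd⟩ := (leadsSquares_diagonalE a b).exists_eq_sum
    ((rank_diagonalE a b).trans h8) hmem (commutator_E_mem_span a b i)
  rw [sum_cyclic _ i, commutator_E] at hd
  refine ⟨d i, d (i + 1), d (i + 2), ?_⟩
  set p := d i
  set q := d (i + 1)
  set r := d (i + 2)
  set α : Fin 3 → Fin 3 → RatField := fun l m => algebraMap ℂ RatField (a l m) with hα
  set β : Fin 3 → RatField := fun l => algebraMap ℂ RatField (b l) with hβ
  obtain ⟨k1, k2, k3, k4, k5, k6⟩ := coefficients_eq_zero
    (partialDer i) (partialDer (i + 1)) (partialDer (i + 2))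
    (tvar i) (tvar (i + 1)) (tvar (i + 2))
    (partialDer_tvar_self _) (partialDer_tvar_of_ne h1.symm) (partialDer_tvar_of_ne h2.symm)
    (partialDer_tvar_of_ne h1) (partialDer_tvar_self _) (partialDer_tvar_of_ne h3.symm)
    (partialDer_tvar_of_ne h2) (partialDer_tvar_of_ne h3) (partialDer_tvar_self _)
    (p * (1 - tvar i ^ 2) + 2 * α i i)
    (q * (1 - tvar (i + 1) ^ 2) - 2 * α (i + 1) (i + 1))
    (r * (1 - tvar (i + 2) ^ 2) - 2 * (α (i + 1) (i + 2) - α i (i + 2)))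
    ((tvar (i + 2) - tvar i * tvar (i + 1)) * (p + q - r))
    ((tvar (i + 1) - tvar (i + 2) * tvar i) * (p + r - q) +
      2 * (α i i + α i (i + 2) - α i (i + 1)) * tvar (i + 1))
    ((tvar i - tvar (i + 1) * tvar (i + 2)) * (q + r - p) -
      2 * (α (i + 1) (i + 1) + α (i + 1) (i + 2) - α (i + 1) i) * tvar i)
    (((-p + q + r) * α i i + (p - q + r) * α (i + 1) i + (p + q - r) * α (i + 2) i) / 2 * tvar i)
    (((-p + q + r) * α i (i + 1) + (p - q + r) * α (i + 1) (i + 1) +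
      (p + q - r) * α (i + 2) (i + 1)) / 2 * tvar (i + 1))
    (((-p + q + r) * α i (i + 2) + (p - q + r) * α (i + 1) (i + 2) +
      (p + q - r) * α (i + 2) (i + 2)) / 2 * tvar (i + 2))
    (((-p + q + r) * β i + (p - q + r) * β (i + 1) + (p + q - r) * β (i + 2)) / 2)
    (by
      intro f
      have hf := congrArg (fun X => action X f) hd
      simp only [map_add, map_sub, map_mul, LinearMap.add_apply, LinearMap.sub_apply, action_smul,
        Module.End.mul_apply, action_deriv, map_ofNat, action_diagonalE, action_E,
        add_one_add_one, add_one_add_two, add_two_add_one, add_two_add_two] at hf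
      rw [partialDer_comm (i + 2) i] at hf
      simp only [hα, hβ]
      linear_combination hf)
  simp only [hα] at k1 k2 k3 k4 k5 k6
  simp only [map_mul, map_add, map_sub, map_ofNat]
  refine ⟨?_, ?_, ?_, k4, ?_, ?_⟩
  · linear_combination k1
  · linear_combination k2
  · linear_combination k3
  · linear_combination k5
  · linear_combination k6

theorem algebraMap_ne_zero {p : Poly} {v : Fin 3 → ℂ} (h : eval v p ≠ 0) :
    algebraMap Poly RatField p ≠ 0 := by
  intro h0
  apply h
  rw [← map_zero (algebraMap Poly RatField)] at h0
  rw [eval_eq_of_algebraMap_eq h0, map_zero]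

theorem relations_of_rank_eq (h8 : (E a b).rank = 8) (i : Fin 3) :
    a i i = 0 ∧ a (i + 1) (i + 2) = a (i + 1) i ∧ a i (i + 2) = a i (i + 1) ∧
      a (i + 1) (i + 2) = a i (i + 2) := by
  obtain ⟨h1, h2, h3⟩ := ne_cyclic i
  obtain ⟨p, q, r, k1, k2, k3, k4, k5, k6⟩ := exists_symbol_relations a b h8 i
  have hC : ∀ c, algebraMap Poly RatField (C c) = algebraMap ℂ RatField c := fun c =>
    (IsScalarTower.algebraMap_apply ℂ Poly RatField c).symm
  have hX : ∀ l, algebraMap Poly RatField (X l) = tvar l := fun l => rfl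
  have hsq : ∀ l, (1 - tvar l ^ 2 : RatField) ≠ 0 := fun l => by
    have h := algebraMap_ne_zero (p := 1 - X l ^ 2) (v := 0) (by simp)
    rwa [map_sub, map_pow, map_one, hX] at h
  have hk : (tvar (i + 2) - tvar i * tvar (i + 1) : RatField) ≠ 0 := by
    have h := algebraMap_ne_zero (p := X (i + 2) - X i * X (i + 1)) (v := Pi.single (i + 2) 1)
      (by simp [h2])
    rwa [map_sub, map_mul, hX, hX, hX] at h
  have hr : p + q - r = 0 := (mul_eq_zero.1 k4).resolve_left hk
  -- Cleared of denominators, `p + q = r` is a polynomial identity; at the point where one variable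
  -- is `1` and the others are `0`, only one of its three terms survives.
  have hpoly : algebraMap Poly RatField
      (C (a (i + 1) (i + 2) - a i (i + 2)) * (1 - X i ^ 2) * (1 - X (i + 1) ^ 2)) =
      algebraMap Poly RatField (-C (a i i) * (1 - X (i + 1) ^ 2) * (1 - X (i + 2) ^ 2) +
        C (a (i + 1) (i + 1)) * (1 - X i ^ 2) * (1 - X (i + 2) ^ 2)) := by
    simp only [map_mul, map_sub, map_add, map_neg, map_pow, map_one, hC, hX, map_ofNat]
      at k1 k2 k3 ⊢
    linear_combination
      (-(1 - tvar i ^ 2) * (1 - tvar (i + 1) ^ 2) * k3 +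
      (1 - tvar (i + 1) ^ 2) * (1 - tvar (i + 2) ^ 2) * k1 +
      (1 - tvar i ^ 2) * (1 - tvar (i + 2) ^ 2) * k2 -
      (1 - tvar i ^ 2) * (1 - tvar (i + 1) ^ 2) * (1 - tvar (i + 2) ^ 2) * hr) / 2
  have e1 := eval_eq_of_algebraMap_eq hpoly (Pi.single i 1)
  have e2 := eval_eq_of_algebraMap_eq hpoly (Pi.single (i + 1) 1)
  have e3 := eval_eq_of_algebraMap_eq hpoly (Pi.single (i + 2) 1)
  simp [h1, h2, h3, h1.symm, h2.symm, h3.symm] at e1 e2 e3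
  have hp : p = 0 := by simpa [e1, hsq] using k1
  have hq : q = 0 := by simpa [← e2, hsq] using k2
  have hr' : r = 0 := by simpa [hp, hq] using hr
  have ht : ∀ l, tvar l ≠ 0 := fun l => by
    rw [← hX]
    exact algebraMap_ne_zero (v := Pi.single l 1) (by simp)
  have hz : ∀ c : ℂ, algebraMap ℂ RatField c = 0 ↔ c = 0 := fun c =>
    map_eq_zero_iff _ (algebraMap ℂ RatField).injective
  rw [hp, hq, hr'] at k5 k6
  simp only [add_zero, sub_zero, mul_zero, zero_eq_neg, zero_eq_mul, hz, ht, or_false,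
    mul_eq_zero, two_ne_zero, false_or] at k5 k6
  refine ⟨e1, ?_, ?_, sub_eq_zero.1 e3⟩
  · rw [← e2] at k6
    linear_combination k6
  · rw [e1] at k5
    linear_combination k5

theorem rank_E_eq_iff : (E a b).rank = 8 ↔
    (∀ i, a i i = 0) ∧ ∃ a₀ : ℂ, ∀ i j, i ≠ j → a i j = a₀ := by
  constructor
  · intro h8
    have h := relations_of_rank_eq a b h8
    refine ⟨fun i => (h i).1, a 0 1, ?_⟩
    obtain ⟨-, h01, h02, h03⟩ := h 0
    obtain ⟨-, h11, h12, h13⟩ := h 1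
    simp only [zero_add, Fin.reduceAdd] at h01 h02 h03 h11 h12 h13
    intro i j hij
    fin_cases i <;> fin_cases j <;> simp at hij ⊢ <;> grind
  · rintro ⟨h0, a₀, ha⟩
    exact rank_E_of_eq a b h0 ha

theorem E_eq_Z3 {a₀ : ℂ} (h0 : ∀ i, a i i = 0) (ha : ∀ i j, i ≠ j → a i j = a₀) (A : Fin 4 → ℂ)
    (hA : a₀ = 2 * A 0 - 3) (hb : ∀ i, b i = A i.succ ^ 2 - (A 0 - 1) ^ 2) :
    E a b = Z3 A := by
  funext i
  obtain ⟨h1, h2, -⟩ := ne_cyclic i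
  rw [E, Z3, sum_cyclic _ i, h0, ha _ _ h1, ha _ _ h2, hb, hA, map_zero, zero_mul, zero_mul,
    zero_add, mul_add, mul_assoc, mul_assoc]

end Fuchs

end

theorem theorem1p1 :
    (∀ (a : Fin 3 → Fin 3 → ℂ) (b : Fin 3 → ℂ),
      (Fuchs.E a b).rank = 8 ↔
        (∀ i, a i i = 0) ∧ ∃ a₀ : ℂ, ∀ i j, i ≠ j → a i j = a₀) ∧
    (∀ (a : Fin 3 → Fin 3 → ℂ) (b : Fin 3 → ℂ) (a₀ : ℂ),
      (∀ i, a i i = 0) → (∀ i j, i ≠ j → a i j = a₀) →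
        (∃ A : Fin 4 → ℂ, a₀ = 2 * A 0 - 3 ∧ ∀ i, b i = A i.succ ^ 2 - (A 0 - 1) ^ 2) ∧
        ∀ A : Fin 4 → ℂ, a₀ = 2 * A 0 - 3 → (∀ i, b i = A i.succ ^ 2 - (A 0 - 1) ^ 2) →
          Fuchs.E a b = Fuchs.Z3 A) ∧
    (∀ A : Fin 4 → ℂ, (Fuchs.Z3 A).rank = 8) := by
  refine ⟨Fuchs.rank_E_eq_iff, fun a b a₀ h0 ha => ⟨?_, Fuchs.E_eq_Z3 a b h0 ha⟩, fun A => ?_⟩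
  · choose s hs using fun i => IsAlgClosed.exists_pow_nat_eq
      (b i + ((a₀ + 3) / 2 - 1) ^ 2) (Nat.succ_pos 1)
    refine ⟨Fin.cons ((a₀ + 3) / 2) s, ?_, fun i => ?_⟩
    · rw [Fin.cons_zero]
      ring
    · rw [Fin.cons_zero, Fin.cons_succ]
      linear_combination -(hs i)
  · let a : Fin 3 → Fin 3 → ℂ := fun i j => if i = j then 0 else 2 * A 0 - 3
    have h0 : ∀ i, a i i = 0 := fun i => if_pos rfl
    have ha : ∀ i j, i ≠ j → a i j = 2 * A 0 - 3 := fun i j h => if_neg h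
    rw [← Fuchs.E_eq_Z3 a (fun i => A i.succ ^ 2 - (A 0 - 1) ^ 2) h0 ha A rfl fun _ => rfl]
    exact Fuchs.rank_E_of_eq _ _ h0 ha
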